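/- A dynamical system $(X,T)$ is a compact metric space $(X,\rho)$ with a continuous map $T\colon X\to X$. It is *transitive* if for all non-empty open $U,V\subseteq X$ there is an integer $n\ge 1$ with $U\cap T^{-n}V\neq\emptyset$; *totally transitive* if $(X,T^k)$ is transitive for every integer $k\ge 1$; *proximal* if $\liminf_{n\to\infty}\rho(T^nx,T^ny)=0$ for all $x,y\in X$; and *uniformly rigid* if there is an increasing sequence $(n_k)$ of positive integers such that $\lim_{k\to\infty}\sup_{x\in X}\rho(T^{n_k}x,x)=0$. For positive integers $r,s$, a pair $(x,y)\in X\times X$ is *$(r,s)$-scrambled* if $$\liminf_{n\to\infty}\rho(T^{rn}x,T^{sn}y)=0\quad\text{and}\quad\limsup_{n\to\infty}\rho(T^{rn}x,T^{sn}y)>0.$$ **Theorem.** (1) If $(X,T)$ is a totally transitive, proximal and uniformly rigid dynamical system, then $(x,y)$ is $(r,s)$-scrambled for any two distinct points $x,y\in X$ and any positive integers $r,s$. (2) There exists a dynamical system $(X,T)$, with $X$ having at least two points, that is totally transitive, proximal and uniformly rigid; consequently $(x,y)$ is $(r,s)$-scrambled for any two distinct $x,y\in X$ and any positive integers $r,s$.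 -/

import Mathlib

open Filter Topology

universe u

namespace TopDyn

/-- `T` is (topologically) transitive: for all non-empty open `U`, `V` there is a positive
integer `n` with `U ∩ T⁻ⁿ V ≠ ∅`. -/
def IsTransitive {X : Type*} [TopologicalSpace X] (T : X → X) : Prop :=
  ∀ U V : Set X, IsOpen U → U.Nonempty → IsOpen V → V.Nonempty →
    ∃ n : ℕ, 0 < n ∧ (U ∩ T^[n] ⁻¹' V).Nonempty

/-- `T` is totally transitive: every positive power of `T` is transitive. -/
def IsTotallyTransitive {X : Type*} [TopologicalSpace X] (T : X → X) : Prop :=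
  ∀ k : ℕ, 0 < k → IsTransitive T^[k]

/-- The `(r, s)`-proximal relation
`Prox(Tʳ, Tˢ) = {(x, y) | liminf_{n → ∞} ρ(T^{rn} x, T^{sn} y) = 0}`.
(On a compact space the distances are bounded, so the real `liminf` is the usual one.) -/
def Prox {X : Type*} [MetricSpace X] (T : X → X) (r s : ℕ) : Set (X × X) :=
  {p | liminf (fun n : ℕ => dist (T^[r * n] p.1) (T^[s * n] p.2)) atTop = 0}

/-- The system is proximal: every pair of points is proximal. -/
def IsProximal {X : Type*} [MetricSpace X] (T : X → X) : Prop :=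
  Prox T 1 1 = Set.univ

/-- The pair `(x, y)` is `(r, s)`-scrambled: the `liminf` of `ρ(T^{rn} x, T^{sn} y)` is zero and
its `limsup` is positive. -/
def IsScrambledPair {X : Type*} [MetricSpace X] (T : X → X) (r s : ℕ) (x y : X) : Prop :=
  liminf (fun n : ℕ => dist (T^[r * n] x) (T^[s * n] y)) atTop = 0 ∧
    0 < limsup (fun n : ℕ => dist (T^[r * n] x) (T^[s * n] y)) atTop

/-- The system is uniformly rigid: for some increasing sequence `(n_k)` of positive integers,
`T^{n_k}` converges to the identity map uniformly on `X`. -/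
def IsUniformlyRigid {X : Type*} [MetricSpace X] (T : X → X) : Prop :=
  ∃ m : ℕ → ℕ, StrictMono m ∧ (∀ k, 0 < m k) ∧
    TendstoUniformly (fun k => T^[m k]) id atTop

end TopDyn

namespace TopDyn

/-! At a minimiser `p` of `dist x (T x)`, proximality of `p` and `T p` forces `T p = p`, and every
orbit comes arbitrarily close to `p`. Compactness brings `T^[r * n] x` and `T^[s * n] y` near `p` at
a common time, so the liminf vanishes. Rigidity makes `T^[r * m k]` and `T^[s * m k]` tend to the
identity, so along `m k` the distance tends to `dist x y`.

For existence, take the shift on the orbit closure of `φ n = ⨆ i, min (1/4) ‖n • a i‖`, with nonzero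
angles `a i` tending to 0. Subadditivity turns times with `φ n` small into uniform almost periods,
hence rigidity; almost periods of the form `1 + k * t` (`exists_angles`) give total transitivity. A
small angle rotates slowly, so `φ` equals `1/4` on arbitrarily long windows with bounded gaps
(`exists_window`); this draws every orbit to the constant point `1/4`, whence proximality. -/

theorem liminf_eq_zero_of_frequently_lt {u : ℕ → ℝ} (h0 : ∀ n, 0 ≤ u n)
    (h : ∀ ε > 0, ∃ᶠ n in atTop, u n < ε) : liminf u atTop = 0 := by
  rw [liminf_eq]
  refine IsGreatest.csSup_eq ⟨Eventually.of_forall h0, fun a ha => ?_⟩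
  by_contra hpos
  exact h a (not_le.1 hpos) (ha.mono fun n hn => not_lt.2 hn)

theorem exists_lt_of_liminf_eq_zero {u : ℕ → ℝ} {B : ℝ} (hB : ∀ n, u n ≤ B)
    (h : liminf u atTop = 0) {ε : ℝ} (hε : 0 < ε) : ∃ n, u n < ε := by
  by_contra! hcon
  have hle : ε ≤ liminf u atTop := by
    rw [liminf_eq]
    refine le_csSup ⟨B, fun a ha => ?_⟩ (Eventually.of_forall hcon)
    obtain ⟨n, hn⟩ := Eventually.exists ha
    exact hn.trans (hB n)
  linarith

/-! ### Proximality to a fixed point, and scrambled pairs -/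

section FixedPoint

variable {X : Type*} [MetricSpace X] {T : X → X} {p : X}

/-- A point close enough to the fixed point stays close for `r` further steps, long enough to meet a
multiple of `r`. -/
theorem exists_iterate_mul_near (hT : Continuous T) (hp : T p = p)
    (h : ∀ x : X, ∀ ε > 0, ∃ n, dist (T^[n] x) p < ε) {r : ℕ} (hr : 0 < r) (x : X)
    {ε : ℝ} (hε : 0 < ε) : ∃ n, dist (T^[r * n] x) p < ε := by
  have hev : ∀ᶠ z in 𝓝 p, ∀ i ∈ Finset.range (r + 1), dist (T^[i] z) p < ε := by
    rw [Filter.eventually_all_finset]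
    intro i _
    have hc : ContinuousAt T^[i] p := (hT.iterate i).continuousAt
    have := Metric.tendsto_nhds.1 hc ε hε
    rwa [Function.iterate_fixed hp] at this
  obtain ⟨δ, hδ, hball⟩ := Metric.eventually_nhds_iff.1 hev
  obtain ⟨m, hm⟩ := h x δ hδ
  refine ⟨m / r + 1, ?_⟩
  have hmod := Nat.mod_lt m hr
  have hdiv := Nat.div_add_mod m r
  have heq : r * (m / r + 1) = (r - m % r) + m := by
    rw [mul_add, mul_one]; omega
  rw [heq, Function.iterate_add_apply]
  exact hball hm _ (Finset.mem_range.2 (by omega))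

theorem exists_iterate_pair_near [CompactSpace X] (hT : Continuous T) (hp : T p = p)
    (h : ∀ x : X, ∀ ε > 0, ∃ n, dist (T^[n] x) p < ε) {r s : ℕ} (hr : 0 < r) (hs : 0 < s)
    (x y : X) {ε : ℝ} (hε : 0 < ε) :
    ∃ n, dist (T^[r * n] x) p < ε ∧ dist (T^[s * n] y) p < ε := by
  choose n hn using fun k : ℕ =>
    exists_iterate_mul_near hT hp h hr x (Nat.one_div_pos_of_nat (α := ℝ) (n := k))
  have hx : Tendsto (fun k => T^[r * n k] x) atTop (𝓝 p) := by
    rw [tendsto_iff_dist_tendsto_zero]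
    exact squeeze_zero (fun _ => dist_nonneg) (fun k => (hn k).le)
      tendsto_one_div_add_atTop_nhds_zero_nat
  obtain ⟨z, φ, hφ, hz⟩ := CompactSpace.tendsto_subseq fun k => T^[s * n k] y
  -- Moving the limit `z` towards `p` costs the first coordinate nothing, since `T^[r * m]` fixes
  -- `p`.
  obtain ⟨m, hm⟩ := exists_iterate_mul_near hT hp h hs z hε
  have h1 : Tendsto (fun k => T^[r * m] (T^[r * n (φ k)] x)) atTop (𝓝 p) := by
    have := ((hT.iterate (r * m)).tendsto p).comp (hx.comp hφ.tendsto_atTop)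
    rwa [Function.iterate_fixed hp] at this
  have h2 : Tendsto (fun k => T^[s * m] (T^[s * n (φ k)] y)) atTop (𝓝 (T^[s * m] z)) :=
    ((hT.iterate (s * m)).tendsto z).comp hz
  obtain ⟨k, hk1, hk2⟩ := ((Metric.tendsto_nhds.1 h1 ε hε).and
    (h2.eventually (Metric.isOpen_ball.mem_nhds hm))).exists
  refine ⟨m + n (φ k), ?_, ?_⟩
  · rwa [mul_add, Function.iterate_add_apply]
  · rwa [mul_add, Function.iterate_add_apply]

theorem liminf_dist_iterate_eq_zero [CompactSpace X] (hT : Continuous T) (hp : T p = p)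
    (h : ∀ x : X, ∀ ε > 0, ∃ n, dist (T^[n] x) p < ε) {r s : ℕ} (hr : 0 < r) (hs : 0 < s)
    (x y : X) : liminf (fun n : ℕ => dist (T^[r * n] x) (T^[s * n] y)) atTop = 0 := by
  refine liminf_eq_zero_of_frequently_lt (fun _ => dist_nonneg) fun ε hε => ?_
  rw [frequently_atTop]
  intro N
  obtain ⟨n, h1, h2⟩ := exists_iterate_pair_near hT hp h hr hs (T^[r * N] x) (T^[s * N] y)
    (half_pos hε)
  refine ⟨n + N, Nat.le_add_left _ _, ?_⟩
  rw [mul_add, mul_add, Function.iterate_add_apply, Function.iterate_add_apply]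
  linarith [dist_triangle_right (T^[r * n] (T^[r * N] x)) (T^[s * n] (T^[s * N] y)) p]

end FixedPoint

theorem IsProximal.exists_dist_iterate_lt {X : Type*} [MetricSpace X] [CompactSpace X] {T : X → X}
    (h : IsProximal T) (x y : X) {ε : ℝ} (hε : 0 < ε) : ∃ n, dist (T^[n] x) (T^[n] y) < ε := by
  have hxy : (x, y) ∈ Prox T 1 1 := h ▸ Set.mem_univ _
  obtain ⟨n, hn⟩ := exists_lt_of_liminf_eq_zero
    (fun n => Metric.dist_le_diam_of_mem (Metric.isBounded_of_compactSpace (s := Set.univ))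
      (Set.mem_univ _) (Set.mem_univ _)) hxy hε
  exact ⟨n, by simpa using hn⟩

theorem IsProximal.exists_fixedPoint {X : Type*} [MetricSpace X] [CompactSpace X] [Nonempty X]
    {T : X → X} (hT : Continuous T) (h : IsProximal T) : ∃ p, T p = p := by
  obtain ⟨p, -, hp⟩ := isCompact_univ.exists_isMinOn Set.univ_nonempty
    (continuous_id.dist hT).continuousOn
  refine ⟨p, (dist_le_zero.1 (le_of_forall_pos_le_add fun ε hε => ?_)).symm⟩
  obtain ⟨n, hn⟩ := h.exists_dist_iterate_lt p (T p) hε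
  have := hp (Set.mem_univ (T^[n] p))
  simp only [Set.mem_ofPred_eq, id, ← Function.iterate_succ_apply', Function.iterate_succ_apply] at this
  linarith

theorem IsUniformlyRigid.limsup_dist_iterate_pos {X : Type*} [MetricSpace X] [CompactSpace X]
    {T : X → X} (h : IsUniformlyRigid T) (r s : ℕ) {x y : X} (hxy : x ≠ y) :
    0 < limsup (fun n : ℕ => dist (T^[r * n] x) (T^[s * n] y)) atTop := by
  obtain ⟨m, hm, -, hlim⟩ := h
  have hmul : ∀ r : ℕ, ∀ ε > 0, ∀ᶠ k in atTop, ∀ x : X, dist (T^[r * m k] x) x < ε := by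
    intro r
    induction r with
    | zero => intro ε hε; exact Eventually.of_forall fun k x => by simpa using hε
    | succ r ih =>
      intro ε hε
      filter_upwards [ih _ (half_pos hε), Metric.tendstoUniformly_iff.1 hlim _ (half_pos hε)]
        with k h1 h2 x
      rw [add_mul, one_mul, add_comm, Function.iterate_add_apply]
      have h3 := h2 (T^[r * m k] x)
      rw [dist_comm] at h3
      simp only [id] at h3
      linarith [h1 x, dist_triangle (T^[m k] (T^[r * m k] x)) (T^[r * m k] x) x]
  have hpos : 0 < dist x y := dist_pos.2 hxy
  refine lt_of_lt_of_le (half_pos hpos) (le_limsup_of_frequently_le ?_ ?_)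
  · have hev : ∀ᶠ k in atTop, dist x y / 2 ≤ dist (T^[r * m k] x) (T^[s * m k] y) := by
      filter_upwards [hmul r (dist x y / 4) (by linarith), hmul s (dist x y / 4) (by linarith)]
        with k h1 h2
      have := h1 x
      rw [dist_comm] at this
      linarith [h2 y, dist_triangle4 x (T^[r * m k] x) (T^[s * m k] y) y]
    exact hm.tendsto_atTop.frequently hev.frequently
  · exact ⟨_, eventually_map.2 (Eventually.of_forall fun n =>
      Metric.dist_le_diam_of_mem (Metric.isBounded_of_compactSpace (s := Set.univ))
        (Set.mem_univ _) (Set.mem_univ _))⟩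

theorem isScrambledPair_of_isProximal_of_isUniformlyRigid {X : Type*} [MetricSpace X]
    [CompactSpace X] {T : X → X} (hT : Continuous T) (hprox : IsProximal T)
    (hrig : IsUniformlyRigid T) {r s : ℕ} (hr : 0 < r) (hs : 0 < s) {x y : X} (hxy : x ≠ y) :
    IsScrambledPair T r s x y := by
  refine ⟨?_, hrig.limsup_dist_iterate_pos r s hxy⟩
  have : Nonempty X := ⟨x⟩
  obtain ⟨p, hp⟩ := hprox.exists_fixedPoint hT
  refine liminf_dist_iterate_eq_zero hT hp (fun z ε hε => ?_) hr hs x y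
  obtain ⟨n, hn⟩ := hprox.exists_dist_iterate_lt z p hε
  exact ⟨n, by rwa [Function.iterate_fixed hp] at hn⟩

end TopDyn
-- Angles on the circle
namespace TopDyn

theorem exists_one_add_mul_nsmul_mem {β : ℝ} (hβ : Irrational β) {k : ℕ} (hk : 0 < k)
    {U : Set UnitAddCircle} (hU : U ∈ 𝓝 0) : ∃ t : ℕ, (1 + k * t) • (β : UnitAddCircle) ∈ U := by
  have hd : DenseRange (· • ((k * β : ℝ) : UnitAddCircle) : ℤ → UnitAddCircle) := by
    rw [AddCircle.denseRange_zsmul_coe_iff, div_one]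
    exact hβ.natCast_mul hk.ne'
  rw [denseRange_zsmul_iff_nsmul] at hd
  have hc : ContinuousAt (fun z : UnitAddCircle => (β : UnitAddCircle) + z) (-β) := by fun_prop
  have hU' : (fun z : UnitAddCircle => (β : UnitAddCircle) + z) ⁻¹' U ∈ 𝓝 (-(β : UnitAddCircle)) :=
    hc.preimage_mem_nhds (by simpa using hU)
  obtain ⟨_, ⟨t, rfl⟩, hz⟩ := hd.inter_nhds_nonempty hU'
  refine ⟨t, ?_⟩
  have : (1 + k * t) • (β : UnitAddCircle) = β + t • ((k * β : ℝ) : UnitAddCircle) := by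
    rw [add_smul, one_smul, mul_comm, mul_smul, ← nsmul_eq_mul, AddCircle.coe_nsmul]
  rw [this]
  exact hz

theorem eventually_norm_nsmul_le {E : Type*} [SeminormedAddCommGroup E] (n : ℕ) {δ : ℝ}
    (hδ : 0 < δ) : ∀ᶠ z : E in 𝓝 0, ‖n • z‖ ≤ δ := by
  have hc : Continuous fun z : E => ‖n • z‖ := by fun_prop
  have := hc.tendsto 0
  simp only [smul_zero, norm_zero] at this
  exact (this.eventually (gt_mem_nhds hδ)).mono fun _ => le_of_lt

theorem nsmul_coe_ne_zero {β : ℝ} (hβ : Irrational β) {n : ℕ} (hn : n ≠ 0) :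
    n • (β : UnitAddCircle) ≠ 0 := by
  rw [← AddCircle.coe_nsmul, Ne, AddCircle.coe_eq_zero_iff]
  rintro ⟨m, hm⟩
  refine (hβ.natCast_mul hn).ne_int m ?_
  simpa using hm.symm

/-- A null sequence of non-zero angles, all of which are simultaneously almost annihilated by
integers congruent to `1` modulo any prescribed modulus. -/
theorem exists_angles : ∃ a : ℕ → UnitAddCircle, (∀ i, a i ≠ 0) ∧
    (∀ i, ‖a i‖ ≤ 1 / ((i : ℝ) + 1)) ∧
    ∀ k : ℕ, 0 < k → ∀ ε > 0, ∃ t : ℕ, ∀ i, ‖(1 + k * t) • a i‖ ≤ ε := by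
  have hβ := irrational_sqrt_two
  set β := √2
  let N : ℕ × UnitAddCircle × ℕ → ℕ := fun x => 1 + x.1.factorial * x.2.2
  let δ : ℕ → ℝ := fun e => 1 / ((e : ℝ) + 1)
  have hδ : ∀ e, 0 < δ e := fun e => Nat.one_div_pos_of_nat
  obtain ⟨f, hf, hr⟩ := exists_seq_of_forall_finset_exists
    (fun x : ℕ × UnitAddCircle × ℕ => (∃ b : ℕ, x.2.1 = b • (β : UnitAddCircle)) ∧ x.2.1 ≠ 0 ∧
      ‖x.2.1‖ ≤ δ x.1 ∧ ‖N x • x.2.1‖ ≤ δ x.1)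
    (fun x y => x.1 < y.1 ∧ ‖N y • x.2.1‖ ≤ δ y.1 ∧ ‖N x • y.2.1‖ ≤ δ y.1) (by
      intro s hs
      -- First `t` is chosen so that `1 + e! * t` almost annihilates `β`, hence the earlier angles,
      -- which are multiples of `β`. Then the new angle is taken so close to 0 that the old
      -- multipliers and the new one all keep it small.
      let e := s.sup Prod.fst + 1
      choose! b hb using fun x hx => (hs x hx).1
      obtain ⟨t, ht⟩ := exists_one_add_mul_nsmul_mem hβ e.factorial_pos
        ((Filter.eventually_all_finset s).2 fun x _ =>
          eventually_norm_nsmul_le (E := UnitAddCircle) (b x) (hδ e))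
      obtain ⟨c, hc⟩ := exists_one_add_mul_nsmul_mem hβ one_pos
        (((Filter.eventually_all_finset s).2 fun x _ =>
          eventually_norm_nsmul_le (E := UnitAddCircle) (N x) (hδ e)).and
          ((eventually_norm_nsmul_le 1 (hδ e)).and
            (eventually_norm_nsmul_le (1 + e.factorial * t) (hδ e))))
      refine ⟨(e, (1 + 1 * c) • (β : UnitAddCircle), t),
        ⟨⟨_, rfl⟩, nsmul_coe_ne_zero hβ (by omega), ?_, hc.2.2⟩, fun x hx => ⟨?_, ?_, hc.1 x hx⟩⟩
      · simpa only [one_smul] using hc.2.1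
      · exact Nat.lt_succ_of_le (Finset.le_sup (f := Prod.fst) hx)
      · rw [hb x hx, smul_comm]
        exact ht x hx)
  have hmono : StrictMono fun i => (f i).1 := fun i j hij => (hr i j hij).1
  have hδanti : ∀ {m n : ℕ}, m ≤ n → δ n ≤ δ m := fun hmn => Nat.one_div_le_one_div hmn
  refine ⟨fun i => (f i).2.1, fun i => (hf i).2.1, fun i => (hf i).2.2.1.trans
    (hδanti (hmono.id_le i)), fun k hk ε hε => ?_⟩
  obtain ⟨n, hn⟩ := exists_nat_one_div_lt hε
  let j := max k n
  have hj : max k n ≤ (f j).1 := hmono.id_le j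
  obtain ⟨q, hq⟩ : k ∣ (f j).1.factorial := Nat.dvd_factorial hk (le_of_max_le_left hj)
  refine ⟨q * (f j).2.2, fun i => ?_⟩
  have hN : 1 + k * (q * (f j).2.2) = N (f j) := by simp only [N, hq, mul_assoc]
  rw [hN]
  have hle : δ (f j).1 ≤ ε := (hδanti (le_of_max_le_right hj)).trans hn.le
  refine le_trans ?_ hle
  rcases lt_trichotomy i j with h | rfl | h
  · exact (hr i j h).2.1
  · exact (hf _).2.2.2
  · exact (hr j i h).2.2.trans (hδanti (hmono h).le)

theorem quarter_le_norm_coe {z : ℝ} {K : ℤ} (h1 : K + 1 / 4 ≤ z) (h2 : z ≤ K + 3 / 4) :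
    1 / 4 ≤ ‖(z : UnitAddCircle)‖ := by
  rw [UnitAddCircle.norm_eq, le_abs]
  rcases le_or_gt (round z) K with h | h
  · left
    have : (round z : ℝ) ≤ K := by exact_mod_cast h
    linarith
  · right
    have : (K : ℝ) + 1 ≤ round z := by exact_mod_cast h
    linarith

theorem exists_window_of_pos {x : ℝ} (hx : 0 < x) {L : ℕ} (hL : ((L : ℝ) + 1) * x ≤ 1 / 2) :
    ∃ M : ℕ, ∀ m : ℕ, ∃ n ≤ M, ∀ i ≤ L, 1 / 4 ≤ ‖(m + n + i) • (x : UnitAddCircle)‖ := by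
  -- Less than `5/4` separates `m * x` from `K + 1/4`. The first step past `K + 1/4` overshoots by
  -- less than `x`, and `L` more steps stay below `K + 3/4` by `hL`.
  refine ⟨⌈5 / 4 / x⌉₊, fun m => ?_⟩
  let K : ℤ := ⌈m * x⌉
  have hK1 : m * x ≤ K := Int.le_ceil _
  have hK2 : (K : ℝ) < m * x + 1 := Int.ceil_lt_add_one _
  have hpos : 0 ≤ (K + 1 / 4 - m * x) / x := div_nonneg (by linarith) hx.le
  have hn1 := Nat.le_ceil ((K + 1 / 4 - m * x) / x)
  have hn2 := Nat.ceil_lt_add_one hpos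
  rw [div_le_iff₀ hx] at hn1
  rw [← sub_lt_iff_lt_add, lt_div_iff₀ hx] at hn2
  have hle : (K + 1 / 4 - m * x) / x ≤ 5 / 4 / x :=
    div_le_div_of_nonneg_right (by linarith) hx.le
  refine ⟨_, Nat.ceil_mono hle, fun i hi => ?_⟩
  have hi' : (i : ℝ) * x ≤ L * x := by gcongr
  have hi0 : 0 ≤ (i : ℝ) * x := by positivity
  rw [← AddCircle.coe_nsmul, nsmul_eq_mul]
  push_cast
  refine quarter_le_norm_coe (K := K) ?_ ?_ <;> linarith

theorem exists_window {a : UnitAddCircle} (ha : a ≠ 0) {L : ℕ} (hL : ((L : ℝ) + 1) * ‖a‖ ≤ 1 / 2) :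
    ∃ M : ℕ, ∀ m : ℕ, ∃ n ≤ M, ∀ i ≤ L, 1 / 4 ≤ ‖(m + n + i) • a‖ := by
  obtain ⟨x, rfl⟩ := QuotientAddGroup.mk_surjective a
  have hcoe : ((x - round x : ℝ) : UnitAddCircle) = (x : UnitAddCircle) := by
    rw [AddCircle.coe_sub, sub_eq_self, AddCircle.coe_eq_zero_iff]
    exact ⟨round x, by simp⟩
  change (x : UnitAddCircle) ≠ 0 at ha
  change _ * ‖(x : UnitAddCircle)‖ ≤ _ at hL
  rw [UnitAddCircle.norm_eq] at hL
  change ∃ M : ℕ, ∀ m : ℕ, ∃ n ≤ M, ∀ i ≤ L, 1 / 4 ≤ ‖(m + n + i) • (x : UnitAddCircle)‖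
  rw [← hcoe] at ha ⊢
  rcases lt_trichotomy (x - round x) 0 with h | h | h
  · rw [abs_of_neg h] at hL
    simpa only [AddCircle.coe_neg, smul_neg, norm_neg] using
      exists_window_of_pos (neg_pos.2 h) hL
  · exact absurd (by rw [h]; rfl) ha
  · rw [abs_of_pos h] at hL
    exact exists_window_of_pos h hL

end TopDyn
namespace TopDyn

/-- The supremum over `i` of the distances `‖n a i‖` to the nearest integer, truncated at `1 / 4`. -/
noncomputable def truncSup (a : ℕ → UnitAddCircle) (n : ℕ) : ℝ :=
  ⨆ i, min (1 / 4) ‖n • a i‖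

/-! ### Subadditivity of the truncated supremum -/

section TruncSup

variable {a : ℕ → UnitAddCircle}

theorem truncSup_bddAbove (n : ℕ) : BddAbove (Set.range fun i => min (1 / 4) ‖n • a i‖) :=
  ⟨1 / 4, by rintro _ ⟨i, rfl⟩; exact min_le_left _ _⟩

theorem min_le_truncSup (n i : ℕ) : min (1 / 4) ‖n • a i‖ ≤ truncSup a n :=
  le_ciSup (truncSup_bddAbove n) i

theorem truncSup_nonneg (n : ℕ) : 0 ≤ truncSup a n :=
  (le_min (by norm_num) (norm_nonneg _)).trans (min_le_truncSup n 0)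

theorem truncSup_le_quarter (n : ℕ) : truncSup a n ≤ 1 / 4 := ciSup_le fun _ => min_le_left _ _

theorem truncSup_le {n : ℕ} {ε : ℝ} (h : ∀ i, ‖n • a i‖ ≤ ε) : truncSup a n ≤ ε :=
  ciSup_le fun i => (min_le_right _ _).trans (h i)

theorem truncSup_zero : truncSup a 0 = 0 :=
  le_antisymm (truncSup_le fun i => by simp) (truncSup_nonneg 0)

theorem truncSup_eq_quarter {n i : ℕ} (h : 1 / 4 ≤ ‖n • a i‖) : truncSup a n = 1 / 4 :=
  le_antisymm (truncSup_le_quarter n) ((min_eq_left h).ge.trans (min_le_truncSup n i))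

theorem truncSup_le_add_of_norm_le {k m n : ℕ} (h : ∀ i, ‖k • a i‖ ≤ ‖m • a i‖ + ‖n • a i‖) :
    truncSup a k ≤ truncSup a m + truncSup a n := by
  refine ciSup_le fun i => ?_
  refine le_trans ?_ (add_le_add (min_le_truncSup m i) (min_le_truncSup n i))
  have hm := norm_nonneg (m • a i)
  have hn := norm_nonneg (n • a i)
  have hk := h i
  rcases min_cases (1 / 4) ‖m • a i‖ with h1 | h1 <;>
    rcases min_cases (1 / 4) ‖n • a i‖ with h2 | h2 <;>
      rcases min_cases (1 / 4) ‖k • a i‖ with h3 | h3 <;> linarith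

theorem truncSup_add_le (m n : ℕ) : truncSup a (m + n) ≤ truncSup a m + truncSup a n :=
  truncSup_le_add_of_norm_le fun i => by rw [add_smul]; exact norm_add_le _ _

theorem abs_truncSup_add_sub_le (m n : ℕ) : |truncSup a (m + n) - truncSup a m| ≤ truncSup a n := by
  have h := truncSup_add_le (a := a) m n
  have h' : truncSup a m ≤ truncSup a (m + n) + truncSup a n :=
    truncSup_le_add_of_norm_le fun i => by
      rw [add_smul]; exact norm_le_add_norm_add _ _
  rw [abs_le]
  constructor <;> linarith

theorem truncSup_mul_le (d n : ℕ) : truncSup a (d * n) ≤ d * truncSup a n := by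
  induction d with
  | zero => simp [truncSup_zero]
  | succ d ih =>
    rw [Nat.succ_mul]
    refine (truncSup_add_le _ _).trans ?_
    push_cast
    linarith

end TruncSup

/-- The orbit closure of a real sequence under the shift. -/
def orbitClosure (φ : ℕ → ℝ) : Set (ℕ → ℝ) := closure (Set.range fun n i => φ (i + n))

/-! ### Dynamics of the shift on an orbit closure -/

section OrbitClosure

variable {φ : ℕ → ℝ}

theorem isCompact_orbitClosure {b c : ℝ} (h : ∀ n, φ n ∈ Set.Icc b c) :
    IsCompact (orbitClosure φ) := by
  refine (isCompact_univ_pi fun _ : ℕ => isCompact_Icc (a := b) (b := c)).of_isClosed_subset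
    isClosed_closure (closure_minimal ?_ (isClosed_set_pi fun _ _ => isClosed_Icc))
  rintro _ ⟨n, rfl⟩ i -
  exact h _

theorem shift_mem_orbitClosure {x : ℕ → ℝ} (hx : x ∈ orbitClosure φ) :
    (fun i => x (i + 1)) ∈ orbitClosure φ := by
  have hc : Continuous fun (x : ℕ → ℝ) i => x (i + 1) := by fun_prop
  refine map_mem_closure hc hx ?_
  rintro _ ⟨n, rfl⟩
  exact ⟨n + 1, funext fun i => by simp only; congr 1; ring⟩

/-- The shift on the orbit closure of a sequence. -/
def shift (φ : ℕ → ℝ) (x : orbitClosure φ) : orbitClosure φ :=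
  ⟨fun i => x.1 (i + 1), shift_mem_orbitClosure x.2⟩

theorem continuous_coord (i : ℕ) : Continuous fun x : orbitClosure φ => x.1 i :=
  (continuous_apply i).comp continuous_subtype_val

theorem continuous_shift : Continuous (shift φ) :=
  (continuous_pi fun i => continuous_coord (i + 1)).subtype_mk _

theorem shift_iterate_apply (n : ℕ) (x : orbitClosure φ) (i : ℕ) :
    ((shift φ)^[n] x).1 i = x.1 (i + n) := by
  induction n generalizing x with
  | zero => rfl
  | succ n ih =>
    rw [Function.iterate_succ_apply, ih]
    simp only [shift]
    congr 1

/-- The generating sequence as a point of its orbit closure. -/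
def basePoint (φ : ℕ → ℝ) : orbitClosure φ := ⟨φ, subset_closure ⟨0, rfl⟩⟩

theorem basePoint_orbit_apply (n i : ℕ) : ((shift φ)^[n] (basePoint φ)).1 i = φ (i + n) :=
  shift_iterate_apply n _ i

theorem dense_basePoint_orbit : DenseRange fun n => (shift φ)^[n] (basePoint φ) := by
  intro x
  rw [closure_subtype]
  refine closure_mono ?_ x.2
  rintro _ ⟨n, rfl⟩
  exact ⟨_, ⟨n, rfl⟩, funext fun i => basePoint_orbit_apply n i⟩

theorem tendsto_orbitClosure_iff {ι : Type*} {l : Filter ι} {f : ι → orbitClosure φ}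
    {x : orbitClosure φ} :
    Tendsto f l (𝓝 x) ↔ ∀ i, Tendsto (fun n => (f n).1 i) l (𝓝 (x.1 i)) := by
  rw [tendsto_subtype_rng, tendsto_pi_nhds]

/-- If `φ` is almost invariant under suitable shifts by `1 + k t`, its orbit closure is totally
transitive. -/
theorem isTotallyTransitive_shift {ψ : ℕ → ℝ} (hψ : ∀ m n, |φ (m + n) - φ m| ≤ ψ n)
    (hmul : ∀ d n, ψ (d * n) ≤ d * ψ n)
    (h : ∀ k : ℕ, 0 < k → ∀ ε > 0, ∃ t : ℕ, ψ (1 + k * t) ≤ ε) :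
    IsTotallyTransitive (shift φ) := by
  intro k hk U V hU hUne hV hVne
  obtain ⟨i, hi⟩ := dense_basePoint_orbit.exists_mem_open hU hUne
  obtain ⟨j, hj⟩ := dense_basePoint_orbit.exists_mem_open hV hVne
  obtain ⟨l, rfl⟩ : ∃ l, k = l + 1 := ⟨k - 1, by omega⟩
  -- Here `d ≡ i - j` modulo `l + 1`, so `j + d * (1 + (l + 1) * t)` exceeds `i` by a multiple of `l
  -- + 1`; the last summand makes this multiple positive.
  let d := i + j * l + (l + 1)
  choose t ht using fun q : ℕ => h (l + 1) hk _ (Nat.one_div_pos_of_nat (α := ℝ) (n := q))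
  have hlim : Tendsto (fun q => (shift φ)^[j + d * (1 + (l + 1) * t q)] (basePoint φ)) atTop
      (𝓝 ((shift φ)^[j] (basePoint φ))) := by
    refine tendsto_orbitClosure_iff.2 fun p => ?_
    rw [tendsto_iff_dist_tendsto_zero]
    refine squeeze_zero (fun _ => dist_nonneg) (g := fun q : ℕ => (d : ℝ) * (1 / ((q : ℝ) + 1)))
      (fun q => ?_) ?_
    · rw [basePoint_orbit_apply, basePoint_orbit_apply, Real.dist_eq, ← add_assoc]
      exact (hψ _ _).trans ((hmul _ _).trans (mul_le_mul_of_nonneg_left (ht q) (Nat.cast_nonneg d)))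
    · simpa using tendsto_one_div_add_atTop_nhds_zero_nat.const_mul (d : ℝ)
  obtain ⟨q, hq⟩ := (hlim.eventually (hV.mem_nhds hj)).exists
  refine ⟨j + 1 + t q * d, by omega, _, hi, ?_⟩
  rw [Set.mem_preimage, ← Function.iterate_mul, ← Function.iterate_add_apply]
  have heq : (l + 1) * (j + 1 + t q * d) + i = j + d * (1 + (l + 1) * t q) := by
    simp only [d]
    ring
  rw [heq]
  exact hq

theorem abs_shift_iterate_sub_le {ψ : ℕ → ℝ} (hψ : ∀ m n, |φ (m + n) - φ m| ≤ ψ n)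
    (x : orbitClosure φ) (n i : ℕ) : |((shift φ)^[n] x).1 i - x.1 i| ≤ ψ n := by
  have hcl : IsClosed {x : orbitClosure φ | |((shift φ)^[n] x).1 i - x.1 i| ≤ ψ n} := by
    simp only [shift_iterate_apply]
    exact isClosed_le ((continuous_coord _).sub (continuous_coord _)).abs continuous_const
  refine hcl.closure_subset_iff.2 ?_ (dense_basePoint_orbit x)
  rintro _ ⟨m, rfl⟩
  simp only [Set.mem_ofPred_eq, shift_iterate_apply, add_right_comm i n m]
  exact hψ _ _

theorem tendstoUniformly_shift_iterate {ψ : ℕ → ℝ} (hψ : ∀ m n, |φ (m + n) - φ m| ≤ ψ n)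
    {m : ℕ → ℕ} (hm : Tendsto (fun k => ψ (m k)) atTop (𝓝 0)) :
    TendstoUniformly (fun k => (shift φ)^[m k]) id atTop := by
  rw [tendstoUniformly_iff_tendsto, uniformity_subtype, Pi.uniformity, tendsto_comap_iff,
    tendsto_iInf]
  intro i
  rw [tendsto_comap_iff]
  have hu : TendstoUniformly (fun k (x : orbitClosure φ) => ((shift φ)^[m k] x).1 i)
      (fun x => x.1 i) atTop := by
    rw [Metric.tendstoUniformly_iff]
    intro ε hε
    filter_upwards [hm.eventually (gt_mem_nhds hε)] with k hk x
    rw [dist_comm, Real.dist_eq]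
    exact (abs_shift_iterate_sub_le hψ x _ i).trans_lt hk
  exact tendstoUniformly_iff_tendsto.1 hu

/-- The uniform gap bound `M` makes the condition a finite union of closed sets, so it passes from
the dense orbit to every point. -/
theorem exists_shift_iterate_eq_const {c : ℝ}
    (h : ∀ L : ℕ, ∃ M : ℕ, ∀ m, ∃ n ≤ M, ∀ i ≤ L, φ (m + n + i) = c) (x : orbitClosure φ) (L : ℕ) :
    ∃ n, ∀ i ≤ L, ((shift φ)^[n] x).1 i = c := by
  obtain ⟨M, hM⟩ := h L
  have hcl : IsClosed (⋃ n ∈ Set.Iic M, ⋂ i, ⋂ (_ : i ≤ L), {x : orbitClosure φ | x.1 (i + n) = c}) :=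
    (Set.finite_Iic M).isClosed_biUnion fun n _ => isClosed_iInter fun i => isClosed_iInter fun _ =>
      isClosed_eq (continuous_coord _) continuous_const
  have hx := hcl.closure_subset_iff.2 (by
    rintro _ ⟨m, rfl⟩
    obtain ⟨n, hn, hn'⟩ := hM m
    simp only [Set.mem_iUnion, Set.mem_iInter]
    refine ⟨n, hn, fun i hi => ?_⟩
    rw [Set.mem_ofPred_eq, basePoint_orbit_apply, ← hn' i hi]
    congr 1
    ring) (dense_basePoint_orbit x)
  simp only [Set.mem_iUnion, Set.mem_iInter] at hx
  obtain ⟨n, -, hn⟩ := hx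
  exact ⟨n, fun i hi => (shift_iterate_apply n x i).trans (hn i hi)⟩

theorem const_mem_orbitClosure {c : ℝ}
    (h : ∀ L : ℕ, ∃ M : ℕ, ∀ m, ∃ n ≤ M, ∀ i ≤ L, φ (m + n + i) = c) :
    (fun _ => c) ∈ orbitClosure φ := by
  choose n hn using exists_shift_iterate_eq_const h (basePoint φ)
  refine mem_closure_of_tendsto (f := fun L => ((shift φ)^[n L] (basePoint φ)).1) (b := atTop) ?_
    (Eventually.of_forall fun L => ⟨n L, funext fun i => (basePoint_orbit_apply _ i).symm⟩)
  exact tendsto_pi_nhds.2 fun i => tendsto_const_nhds.congr' <|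
    (eventually_ge_atTop i).mono fun L hL => (hn L i hL).symm

theorem tendsto_const_of_windows {c : ℝ} {f : ℕ → orbitClosure φ}
    (hf : ∀ L, ∀ i ≤ L, (f L).1 i = c) {p : orbitClosure φ} (hp : p.1 = fun _ => c) :
    Tendsto f atTop (𝓝 p) := by
  refine tendsto_orbitClosure_iff.2 fun i => tendsto_const_nhds.congr' <|
    (eventually_ge_atTop i).mono fun L hL => ?_
  rw [hp]
  exact (hf L i hL).symm

end OrbitClosure

/-- A recurrent sequence whose shift-orbit closure is the desired system. -/
theorem exists_recurrent_sequence : ∃ φ : ℕ → ℝ, φ 0 = 0 ∧ (∀ n, φ n ∈ Set.Icc (0 : ℝ) (1 / 4)) ∧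
    (∀ m n, |φ (m + n) - φ m| ≤ φ n) ∧ (∀ d n, φ (d * n) ≤ d * φ n) ∧
    (∀ k : ℕ, 0 < k → ∀ ε > 0, ∃ t : ℕ, φ (1 + k * t) ≤ ε) ∧
    ∀ L : ℕ, ∃ M : ℕ, ∀ m, ∃ n ≤ M, ∀ i ≤ L, φ (m + n + i) = 1 / 4 := by
  obtain ⟨a, ha0, ha, hk⟩ := exists_angles
  refine ⟨truncSup a, truncSup_zero, fun n => ⟨truncSup_nonneg n, truncSup_le_quarter n⟩,
    abs_truncSup_add_sub_le, truncSup_mul_le, fun k hk0 ε hε => ?_, fun L => ?_⟩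
  · obtain ⟨t, ht⟩ := hk k hk0 ε hε
    exact ⟨t, truncSup_le ht⟩
  · let j := 2 * L + 1
    have hj : ((L : ℝ) + 1) * ‖a j‖ ≤ 1 / 2 := by
      calc ((L : ℝ) + 1) * ‖a j‖ ≤ ((L : ℝ) + 1) * (1 / ((j : ℝ) + 1)) := by gcongr; exact ha j
        _ = 1 / 2 := by
          have : (L : ℝ) + 1 ≠ 0 := by positivity
          simp only [j]
          push_cast
          field_simp
          ring
    obtain ⟨M, hM⟩ := exists_window (ha0 j) hj
    refine ⟨M, fun m => ?_⟩
    obtain ⟨n, hn, hn'⟩ := hM m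
    exact ⟨n, hn, fun i hi => truncSup_eq_quarter (hn' i hi)⟩

theorem exists_strictMono_tendsto_zero {φ : ℕ → ℝ} (h0 : ∀ n, 0 ≤ φ n)
    (hmul : ∀ d n, φ (d * n) ≤ d * φ n) (h : ∀ ε > 0, ∃ n, 0 < n ∧ φ n ≤ ε) :
    ∃ m : ℕ → ℕ, StrictMono m ∧ (∀ k, 0 < m k) ∧ Tendsto (fun k => φ (m k)) atTop (𝓝 0) := by
  have hfreq : ∀ k : ℕ, ∃ᶠ n in atTop, 0 < n ∧ φ n ≤ 1 / ((k : ℝ) + 1) := by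
    intro k
    rw [frequently_atTop]
    intro N
    have hN : (0 : ℝ) < N + 1 := by positivity
    obtain ⟨n, hn, hn'⟩ := h (1 / ((k : ℝ) + 1) / (N + 1))
      (div_pos Nat.one_div_pos_of_nat hN)
    -- Multiplying by `N + 1` pushes the time past `N`; the tolerance was divided by `N + 1` to pay
    -- for it.
    refine ⟨(N + 1) * n, by nlinarith, by positivity, (hmul _ _).trans ?_⟩
    rw [le_div_iff₀ hN] at hn'
    push_cast
    linarith
  obtain ⟨m, hm, hm'⟩ := extraction_forall_of_frequently hfreq
  exact ⟨m, hm, fun k => (hm' k).1, squeeze_zero (fun _ => h0 _) (fun k => (hm' k).2)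
    tendsto_one_div_add_atTop_nhds_zero_nat⟩

end TopDyn

theorem mainTheorem9 :
    (∀ (X : Type u) [MetricSpace X] [CompactSpace X] (T : X → X), Continuous T →
      TopDyn.IsTotallyTransitive T → TopDyn.IsProximal T → TopDyn.IsUniformlyRigid T →
        ∀ r s : ℕ, 0 < r → 0 < s → ∀ x y : X, x ≠ y → TopDyn.IsScrambledPair T r s x y) ∧
    (∃ (X : Type) (_ : MetricSpace X) (_ : CompactSpace X) (_ : Nontrivial X) (T : X → X),
      Continuous T ∧
      TopDyn.IsTotallyTransitive T ∧ TopDyn.IsProximal T ∧ TopDyn.IsUniformlyRigid T ∧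
        ∀ r s : ℕ, 0 < r → 0 < s → ∀ x y : X, x ≠ y → TopDyn.IsScrambledPair T r s x y) := by
  refine ⟨fun X _ _ T hT _ hprox hrig r s hr hs x y hxy =>
    TopDyn.isScrambledPair_of_isProximal_of_isUniformlyRigid hT hprox hrig hr hs hxy, ?_⟩
  obtain ⟨φ, h0, hIcc, hsub, hmul, hk, hwin⟩ := TopDyn.exists_recurrent_sequence
  -- This metric induces the product uniformity, so the coordinatewise results apply.
  let _ : MetricSpace (ℕ → ℝ) := PiCountable.metricSpace
  have : CompactSpace (TopDyn.orbitClosure φ) :=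
    isCompact_iff_compactSpace.1 (TopDyn.isCompact_orbitClosure hIcc)
  let p : TopDyn.orbitClosure φ := ⟨fun _ => 1 / 4, TopDyn.const_mem_orbitClosure hwin⟩
  have hp : TopDyn.shift φ p = p := rfl
  have hne : Nontrivial (TopDyn.orbitClosure φ) := by
    refine ⟨TopDyn.basePoint φ, p, fun h => ?_⟩
    have := congrFun (congrArg Subtype.val h) 0
    change φ 0 = 1 / 4 at this
    norm_num [h0] at this
  have hT : Continuous (TopDyn.shift φ) := TopDyn.continuous_shift
  have hprox : TopDyn.IsProximal (TopDyn.shift φ) := by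
    refine Set.eq_univ_of_forall fun xy =>
      TopDyn.liminf_dist_iterate_eq_zero hT hp (fun x ε hε => ?_) one_pos one_pos xy.1 xy.2
    choose n hn using TopDyn.exists_shift_iterate_eq_const hwin x
    obtain ⟨L, hL⟩ := ((TopDyn.tendsto_const_of_windows hn rfl : Tendsto _ _ (𝓝 p)).eventually
      (Metric.ball_mem_nhds p hε)).exists
    exact ⟨n L, hL⟩
  have hrig : TopDyn.IsUniformlyRigid (TopDyn.shift φ) := by
    obtain ⟨m, hm, hpos, hlim⟩ := TopDyn.exists_strictMono_tendsto_zero (fun n => (hIcc n).1) hmul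
      fun ε hε => (hk 1 one_pos ε hε).imp' (fun t => 1 + 1 * t) fun t ht => ⟨by omega, ht⟩
    exact ⟨m, hm, hpos, TopDyn.tendstoUniformly_shift_iterate hsub hlim⟩
  exact ⟨TopDyn.orbitClosure φ, inferInstance, this, hne, TopDyn.shift φ, hT,
    TopDyn.isTotallyTransitive_shift hsub hmul hk, hprox, hrig, fun r s hr hs x y hxy =>
      TopDyn.isScrambledPair_of_isProximal_of_isUniformlyRigid hT hprox hrig hr hs hxy⟩
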